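/- Let $a, d \in \mathbb{N}^2$ be linearly independent over $\mathbb{Q}$ (where $\mathbb{N} = \{0,1,2,\ldots\}$), let $k \geq 2$ be an integer, and let $$S_{a,d,k} = \langle a, a+d, a+2d, \ldots, a+kd \rangle = \Big\{ \sum_{i=0}^{k} \lambda_i (a+id) \;:\; \lambda_i \in \mathbb{N} \Big\} \subseteq \mathbb{N}^2$$ be the affine semigroup generated by $a, a+d, \ldots, a+kd$. Assume that $\{a, a+d, \ldots, a+kd\}$ is a minimal generating set of $S_{a,d,k}$, i.e. no proper subset of it generates $S_{a,d,k}$. Then for every field $K$ the semigroup ring $K[S_{a,d,k}] = \bigoplus_{s \in S_{a,d,k}} K\,\mathbf{t}^s$ is Cohen–Macaulay, that is, it is a Noetherian ring whose localization at each maximal ideal has depth equal to its Krull dimension. -/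

import Mathlib

/-- `G` is a minimal generating set of the additive submonoid `S`: it generates `S`,
and no proper subset of `G` does. -/
def IsMinimalGeneratingSet {M : Type*} [AddMonoid M] (S : AddSubmonoid M) (G : Set M) : Prop :=
  AddSubmonoid.closure G = S ∧ ∀ G' : Set M, G' ⊂ G → AddSubmonoid.closure G' ≠ S

/-- The set `{a, a + d, …, a + k d}` in `ℕ²`. -/
def arithmeticGenerators (a d : Fin 2 → ℕ) (k : ℕ) : Set (Fin 2 → ℕ) :=
  {x | ∃ i : ℕ, i ≤ k ∧ x = a + i • d}

/-- The affine semigroup `S_{a,d,k} = ⟨a, a + d, …, a + k d⟩` in `ℕ²`. -/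
def arithmeticSemigroup (a d : Fin 2 → ℕ) (k : ℕ) : AddSubmonoid (Fin 2 → ℕ) :=
  AddSubmonoid.closure (arithmeticGenerators a d k)

/-- The depth of a local ring: the supremum of the lengths of the regular sequences
contained in its maximal ideal. -/
noncomputable def localRingDepth (R : Type*) [CommRing R] [IsLocalRing R] : ℕ∞ :=
  ⨆ rs : {rs : List R //
    (∀ r ∈ rs, r ∈ IsLocalRing.maximalIdeal R) ∧ RingTheory.Sequence.IsRegular R rs},
    (rs.1.length : ℕ∞)

/-- A Noetherian local ring is Cohen–Macaulay if its depth equals its Krull dimension. -/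
structure IsCohenMacaulayLocalRing (R : Type*) [CommRing R] [IsLocalRing R] : Prop where
  isNoetherianRing : IsNoetherianRing R
  depth_eq_dim : (localRingDepth R : WithBot ℕ∞) = ringKrullDim R

/-- A Noetherian ring is Cohen–Macaulay if its localization at every maximal ideal is a
Cohen–Macaulay local ring. -/
structure IsCohenMacaulayRing (R : Type*) [CommRing R] : Prop where
  isNoetherianRing : IsNoetherianRing R
  localization_isCohenMacaulay : ∀ (m : Ideal R) [m.IsMaximal],
    IsCohenMacaulayLocalRing (Localization.AtPrime m)

/-!
The semigroup ring is a finite free module over a polynomial ring in two variables, and any such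
algebra is Cohen–Macaulay.

*Freeness.* Since `a` and `d` are linearly independent, an element of the semigroup is `n a + m d`
for a unique pair `(n, m)`, and the pairs that occur are exactly those with `m ≤ k n`
(`mem_arithmeticSemigroup_iff`). Dividing `m` by `k` shows that every element is uniquely of the
form `α a + β (a + k d) + w` with `w` one of `0, a + d, …, a + (k - 1) d`
(`arithmeticApery_decomposition_bijective`). Hence `K[S]` is free over `K[X][Y]`, where `X` and `Y`
act as `t ^ a` and `t ^ (a + k d)`, with basis the monomials `t ^ w`
(`exists_basis_of_smul_basis`).

*Finite flat algebras over `K[X][Y]`.* Let `R` be such an algebra and `m` a maximal ideal of `R`.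
By integrality, `m` lies over a maximal ideal of `K[X][Y]`, and that ideal contains a weakly regular
sequence of length two (`exists_isWeaklyRegular_pair_of_isMaximal`). By flatness this gives a
regular sequence of length two in `R_m`, while `dim R_m ≤ dim R ≤ dim K[X][Y] = 2`
(`ringKrullDim_le_of_isIntegral`). The length of a regular sequence never exceeds the dimension, so
depth and dimension of `R_m` are both two (`IsCohenMacaulayLocalRing.of_isRegular`).
-/

/-! ### Regular sequences in the polynomial ring in two variables -/

open Polynomial in
/-- The contraction of `P` to `K[X]` is generated by a prime `f`; as `(f)` is not maximal in
`K[X][Y]`, there is `g ∈ P` outside it, and `f, g` is the required sequence. The ring `K[X][Y]` is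
written `K[X][X]`, the outer variable being `Y`. -/
theorem exists_isWeaklyRegular_pair_of_isMaximal {K : Type*} [Field K] (P : Ideal K[X][X])
    [P.IsMaximal] :
    ∃ x ∈ P, ∃ y ∈ P, RingTheory.Sequence.IsWeaklyRegular K[X][X] [x, y] := by
  have hp : (P.comap (C : K[X] →+* K[X][X])).IsMaximal :=
    Polynomial.isMaximal_comap_C_of_isJacobsonRing P
  obtain ⟨f, hf⟩ := (IsPrincipalIdealRing.principal (P.comap (C : K[X] →+* K[X][X]))).principal
  have hf' : P.comap (C : K[X] →+* K[X][X]) = Ideal.span {f} := hf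
  have hf0 : f ≠ 0 := by
    rintro rfl
    refine Ring.ne_bot_of_isMaximal_of_not_isField hp (Polynomial.not_isField K) ?_
    simpa using hf'
  have hfp : Prime f := by
    rw [← Ideal.span_singleton_prime hf0, ← hf']
    exact hp.isPrime
  have hCf : Prime (C f) := Polynomial.prime_C_iff.2 hfp
  have hfP : C f ∈ P := by
    have : f ∈ P.comap (C : K[X] →+* K[X][X]) := hf' ▸ Ideal.mem_span_singleton_self f
    exact this
  -- If `P = (f)`, then `Y ∉ P`, so `Y` is invertible modulo `f`; comparing constant terms, `f ∣ 1`.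
  have hne : ∃ g ∈ P, ¬ C f ∣ g := by
    by_contra! h
    have hPX : (X : K[X][X]) ∉ P := fun hX => by
      obtain ⟨q, hq⟩ := h X hX
      have := congrArg (fun r : K[X][X] => r.coeff 1) hq
      simp only [coeff_X_one, coeff_C_mul] at this
      exact hfp.not_isUnit (IsUnit.of_mul_eq_one _ this.symm)
    obtain ⟨r, s, hs, hrs⟩ := (inferInstance : P.IsMaximal).exists_inv hPX
    obtain ⟨q, rfl⟩ := h s hs
    have := congrArg (fun r : K[X][X] => r.coeff 0) hrs
    simp only [coeff_add, mul_coeff_zero, coeff_X_zero, coeff_C_zero, coeff_one_zero] at this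
    exact hfp.not_isUnit (IsUnit.of_mul_eq_one (q.coeff 0) (by linear_combination this))
  obtain ⟨g, hgP, hg⟩ := hne
  refine ⟨C f, hfP, g, hgP, ?_⟩
  rw [RingTheory.Sequence.isWeaklyRegular_cons_iff,
    RingTheory.Sequence.isWeaklyRegular_singleton_iff]
  refine ⟨fun u v huv => mul_left_cancel₀ hCf.ne_zero huv, ?_⟩
  rw [isSMulRegular_iff_right_eq_zero_of_smul]
  intro z hz
  obtain ⟨h, rfl⟩ := Submodule.Quotient.mk_surjective _ z
  rw [← Submodule.Quotient.mk_smul, Submodule.Quotient.mk_eq_zero,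
    Submodule.mem_smul_pointwise_iff_exists] at hz
  rw [Submodule.Quotient.mk_eq_zero, Submodule.mem_smul_pointwise_iff_exists]
  obtain ⟨q, -, hq⟩ := hz
  obtain ⟨w, hw⟩ := (hCf.dvd_or_dvd (Dvd.intro q hq)).resolve_left hg
  exact ⟨w, trivial, hw.symm⟩

/-! ### Criteria for Cohen–Macaulayness -/

/-- Contraction of primes is strictly monotone along an integral extension. -/
theorem ringKrullDim_le_of_isIntegral (A R : Type*) [CommRing A] [CommRing R] [Algebra A R]
    [Algebra.IsIntegral A R] : ringKrullDim R ≤ ringKrullDim A := by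
  refine Order.krullDim_le_of_strictMono (PrimeSpectrum.comap (algebraMap A R)) fun p q hpq => ?_
  exact Ideal.IsIntegral.comap_lt_comap hpq

/-- A regular sequence lowers the dimension by its length, so none is longer than the dimension;
one of length `dim R` therefore determines the depth. -/
theorem IsCohenMacaulayLocalRing.of_isRegular {R : Type*} [CommRing R] [IsLocalRing R]
    [IsNoetherianRing R] (rs : List R) (hmem : ∀ r ∈ rs, r ∈ IsLocalRing.maximalIdeal R)
    (hreg : RingTheory.Sequence.IsRegular R rs) (hdim : ringKrullDim R ≤ rs.length) :
    IsCohenMacaulayLocalRing R := by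
  have hle : ∀ ss : List R, RingTheory.Sequence.IsRegular R ss →
      ((ss.length : ℕ∞) : WithBot ℕ∞) ≤ ringKrullDim R := fun ss hss => by
    rw [← ringKrullDim_add_length_eq_ringKrullDim_of_isRegular ss hss]
    have : Nontrivial (R ⧸ Ideal.ofList ss) := by
      refine Ideal.Quotient.nontrivial_iff.2 fun h => hss.top_ne_smul ?_
      simp [h]
    exact le_add_of_nonneg_left ringKrullDim_nonneg_of_nontrivial
  have hd : ringKrullDim R = ((rs.length : ℕ∞) : WithBot ℕ∞) := le_antisymm hdim (hle rs hreg)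
  refine ⟨inferInstance, ?_⟩
  rw [hd, localRingDepth]
  congr 1
  refine le_antisymm (iSup_le fun ss => ?_) ?_
  · exact WithBot.coe_le_coe.1 (hd ▸ hle ss.1 ss.2.2)
  · exact le_iSup (fun ss : {ss : List R // (∀ r ∈ ss, r ∈ IsLocalRing.maximalIdeal R) ∧
      RingTheory.Sequence.IsRegular R ss} => (ss.1.length : ℕ∞)) ⟨rs, hmem, hreg⟩

open Polynomial in
theorem IsCohenMacaulayRing.of_finite_flat (K : Type*) {R : Type*} [Field K] [CommRing R]
    [Algebra K[X][X] R] [Module.Finite K[X][X] R] [Module.Flat K[X][X] R] :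
    IsCohenMacaulayRing R := by
  have hN : IsNoetherianRing R := IsNoetherianRing.of_finite K[X][X] R
  refine ⟨hN, fun m _ => ?_⟩
  have : (m.comap (algebraMap K[X][X] R)).IsMaximal :=
    Ideal.isMaximal_comap_of_isIntegral_of_isMaximal m
  obtain ⟨x, hx, y, hy, hxy⟩ :=
    exists_isWeaklyRegular_pair_of_isMaximal (m.comap (algebraMap K[X][X] R))
  have hmem : ∀ r ∈ [x, y].map (algebraMap K[X][X] R), r ∈ m := by
    simp only [List.map_cons, List.map_nil, List.mem_cons, List.not_mem_nil, or_false]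
    rintro r (rfl | rfl)
    exacts [hx, hy]
  have hreg := (hxy.of_flat (S := R)).isRegular_of_isLocalization_of_mem
    (Localization.AtPrime m) m hmem
  have : IsNoetherianRing (Localization.AtPrime m) :=
    IsLocalization.isNoetherianRing m.primeCompl _ hN
  refine .of_isRegular _ (fun r hr => ?_) hreg ?_
  · obtain ⟨s, hs, rfl⟩ := List.mem_map.1 hr
    exact (IsLocalization.AtPrime.to_map_mem_maximal_iff _ m s).2 (hmem s hs)
  · rw [IsLocalization.AtPrime.ringKrullDim_eq_height m]
    refine (Ideal.height_le_ringKrullDim_of_ne_top (Ideal.IsPrime.ne_top inferInstance)).trans ?_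
    refine (ringKrullDim_le_of_isIntegral K[X][X] R).trans ?_
    rw [Polynomial.ringKrullDim_of_isNoetherianRing, Polynomial.ringKrullDim_of_isNoetherianRing,
      ringKrullDim_eq_zero_of_field]
    simp
    norm_num

/-! ### Free modules over a `K`-algebra from `K`-bases -/

open Module in
/-- If the products of the members of a `K`-basis of `A` with the elements `u j` form a `K`-basis of
the `A`-algebra `R`, without repetition, then the `u j` form an `A`-basis of `R`. -/
theorem exists_basis_of_smul_basis {K A R ι κ τ : Type*} [CommSemiring K] [CommSemiring A]
    [CommSemiring R] [Algebra K A] [Algebra A R] [Algebra K R] [IsScalarTower K A R]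
    (bA : Basis ι K A) (b : Basis τ K R) (u : κ → R) (e : (Σ _ : κ, ι) ≃ τ)
    (h : ∀ j i, b (e ⟨j, i⟩) = bA i • u j) : ∃ b' : Basis κ A R, ⇑b' = u := by
  have hΦ : (Finsupp.linearCombination A u).restrictScalars K =
      ((Finsupp.basis fun _ : κ => bA).equiv b e : (κ →₀ A) →ₗ[K] R) := by
    refine (Finsupp.basis fun _ : κ => bA).ext fun ⟨j, i⟩ => ?_
    rw [LinearMap.restrictScalars_apply, LinearEquiv.coe_coe, Basis.equiv_apply, h,
      Finsupp.coe_basis, Finsupp.linearCombination_single]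
  have hbij : Function.Bijective (Finsupp.linearCombination A u) := by
    have := ((Finsupp.basis fun _ : κ => bA).equiv b e).bijective
    convert! this using 1
    exact congrArg DFunLike.coe hΦ
  refine ⟨.ofRepr (LinearEquiv.ofBijective _ hbij).symm, funext fun j => ?_⟩
  simp

/-! ### The structure of the semigroup -/

theorem arithmetic_combination_injective {a d : Fin 2 → ℕ}
    (hind : LinearIndependent ℚ
      ![(fun i => (a i : ℚ) : Fin 2 → ℚ), (fun i => (d i : ℚ) : Fin 2 → ℚ)])
    {n m n' m' : ℕ} (h : n • a + m • d = n' • a + m' • d) : n = n' ∧ m = m' := by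
  rw [LinearIndependent.pair_iff] at hind
  have := hind ((n : ℚ) - n') ((m : ℚ) - m') (by
    ext i
    have hi := congrArg (fun x : ℕ => (x : ℚ)) (congrFun h i)
    simp at hi ⊢
    linear_combination hi)
  constructor
  · exact_mod_cast sub_eq_zero.1 this.1
  · exact_mod_cast sub_eq_zero.1 this.2

/-- For linearly independent `a` and `d`, this identifies the semigroup with the lattice points of
a cone, generated by `(1, 0)` and `(1, k)` in the coordinates `(n, m)`. -/
theorem mem_arithmeticSemigroup_iff {a d : Fin 2 → ℕ} {k : ℕ} {s : Fin 2 → ℕ} :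
    s ∈ arithmeticSemigroup a d k ↔ ∃ n m : ℕ, m ≤ k * n ∧ s = n • a + m • d := by
  constructor
  · intro hs
    induction hs using AddSubmonoid.closure_induction with
    | mem x hx =>
      obtain ⟨i, hi, rfl⟩ := hx
      exact ⟨1, i, by simpa using hi, by simp⟩
    | zero => exact ⟨0, 0, by simp, by simp⟩
    | add x y _ _ hx hy =>
      obtain ⟨n, m, h, rfl⟩ := hx
      obtain ⟨n', m', h', rfl⟩ := hy
      exact ⟨n + n', m + m', by nlinarith, by simp only [add_smul]; abel⟩
  · rintro ⟨n, m, h, rfl⟩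
    induction n generalizing m with
    | zero =>
      obtain rfl : m = 0 := by simpa using h
      simp
    | succ n ih =>
      -- Split off one generator `a + i d`, with `i` as large as possible.
      have hg : a + (min m k) • d ∈ arithmeticSemigroup a d k :=
        AddSubmonoid.subset_closure ⟨_, min_le_right _ _, rfl⟩
      have h1 := ih (m - min m k) (by rw [mul_add] at h; omega)
      have h2 := add_mem h1 hg
      convert! h2 using 1
      have : m = (m - min m k) + min m k := by omega
      conv_lhs => rw [this]
      simp only [add_smul, one_smul]; abel

/-- The element `a + i d` of the semigroup, for `i ≤ k`. -/
def arithmeticGen (a d : Fin 2 → ℕ) {k i : ℕ} (h : i ≤ k) : arithmeticSemigroup a d k :=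
  ⟨a + i • d, AddSubmonoid.subset_closure ⟨i, h, rfl⟩⟩

/-- The representatives `0, a + d, …, a + (k - 1) d` of the semigroup modulo the free submonoid
generated by its extremal elements `a` and `a + k d`. -/
def arithmeticApery (a d : Fin 2 → ℕ) {k : ℕ} (j : Fin k) : arithmeticSemigroup a d k :=
  if (j : ℕ) = 0 then 0 else arithmeticGen a d j.2.le

/-- The monoid generated by `a` and `a + k d` acts freely on the semigroup by translation, with the
elements `arithmeticApery a d j` as orbit representatives: an element `n a + m d` determines the
index `j = m % k` and the coefficient `m / k` of `a + k d`. -/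
theorem arithmeticApery_decomposition_bijective {a d : Fin 2 → ℕ} {k : ℕ} (hk : 0 < k)
    (hind : LinearIndependent ℚ
      ![(fun i => (a i : ℚ) : Fin 2 → ℚ), (fun i => (d i : ℚ) : Fin 2 → ℚ)]) :
    Function.Bijective fun x : (Σ _ : Fin k, ℕ × ℕ) =>
      x.2.1 • arithmeticGen a d (Nat.zero_le k) + x.2.2 • arithmeticGen a d le_rfl +
        arithmeticApery a d x.1 := by
  -- Coordinates with respect to `a` and `d`: a nonzero representative contributes one copy of `a`.
  have key : ∀ x : (Σ _ : Fin k, ℕ × ℕ),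
      ((x.2.1 • arithmeticGen a d (Nat.zero_le k) + x.2.2 • arithmeticGen a d le_rfl +
        arithmeticApery a d x.1 : arithmeticSemigroup a d k) : Fin 2 → ℕ) =
      (x.2.1 + x.2.2 + if (x.1 : ℕ) = 0 then 0 else 1) • a + (k * x.2.2 + x.1) • d := by
    rintro ⟨j, α, β⟩
    simp only [arithmeticApery, arithmeticGen]
    split_ifs with h <;> ext i <;> simp [h] <;> ring
  constructor
  · intro x y hxy
    have hxy' := congrArg Subtype.val hxy
    simp only [key] at hxy'
    obtain ⟨h1, h2⟩ := arithmetic_combination_injective hind hxy'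
    obtain ⟨⟨j, hj⟩, α, β⟩ := x
    obtain ⟨⟨j', hj'⟩, α', β'⟩ := y
    simp only at h1 h2
    have e1 : j = j' := by
      have := congrArg (· % k) h2
      simpa [Nat.mod_eq_of_lt hj, Nat.mod_eq_of_lt hj'] using this
    subst e1
    have e2 : β = β' := Nat.eq_of_mul_eq_mul_left hk (by omega)
    subst e2
    obtain rfl : α = α' := by omega
    rfl
  · rintro ⟨s, hs⟩
    obtain ⟨n, m, h, rfl⟩ := mem_arithmeticSemigroup_iff.1 hs
    have hdm := Nat.div_add_mod m k
    have hle : m / k + (if m % k = 0 then 0 else 1) ≤ n := by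
      split_ifs with h0
      · exact Nat.div_le_of_le_mul h
      -- Here `k ∤ m`, so `m < k n`, which leaves room for the copy of `a` in the representative.
      · refine (Nat.div_lt_iff_lt_mul hk).2 ?_
        rcases h.lt_or_eq with h | rfl
        · linarith
        · simp at h0
    refine ⟨⟨⟨m % k, Nat.mod_lt m hk⟩, n - (m / k + if m % k = 0 then 0 else 1), m / k⟩,
      Subtype.ext ?_⟩
    rw [key]
    simp only [hdm]
    congr 2
    omega

/-! ### The semigroup ring -/

theorem mainTheorem1 (K : Type*) [Field K] (a d : Fin 2 → ℕ) (k : ℕ) (hk : 2 ≤ k)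
    (hind : LinearIndependent ℚ
      ![(fun i => (a i : ℚ) : Fin 2 → ℚ), (fun i => (d i : ℚ) : Fin 2 → ℚ)])
    (hmin : IsMinimalGeneratingSet (arithmeticSemigroup a d k) (arithmeticGenerators a d k)) :
    IsCohenMacaulayRing (AddMonoidAlgebra K (arithmeticSemigroup a d k)) := by
  let t : arithmeticSemigroup a d k → AddMonoidAlgebra K (arithmeticSemigroup a d k) :=
    fun s => AddMonoidAlgebra.single s 1
  -- The images of `X` and `Y` are the monomials of the extremal elements `a` and `a + k d`.
  let φ : Polynomial (Polynomial K) →+* AddMonoidAlgebra K (arithmeticSemigroup a d k) :=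
    Polynomial.eval₂RingHom
      (Polynomial.aeval (t (arithmeticGen a d (Nat.zero_le k)))).toRingHom
      (t (arithmeticGen a d le_rfl))
  let : Algebra (Polynomial (Polynomial K)) (AddMonoidAlgebra K (arithmeticSemigroup a d k)) :=
    φ.toAlgebra
  have : IsScalarTower K (Polynomial (Polynomial K))
      (AddMonoidAlgebra K (arithmeticSemigroup a d k)) :=
    IsScalarTower.of_algebraMap_eq fun c => by
      change _ = φ (Polynomial.C (Polynomial.C c))
      simp [φ]
  obtain ⟨b, -⟩ := exists_basis_of_smul_basis
    ((Polynomial.basisMonomials K).smulTower (Polynomial.basisMonomials (Polynomial K)))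
    (AddMonoidAlgebra.basis (arithmeticSemigroup a d k) K) (fun j => t (arithmeticApery a d j))
    (Equiv.ofBijective _ (arithmeticApery_decomposition_bijective (by omega) hind))
    (fun j i => by
      rw [Algebra.smul_def]
      change _ = φ _ * _
      simp [φ, t, AddMonoidAlgebra.single_pow, AddMonoidAlgebra.single_mul_single,
        Module.Basis.smulTower_apply, Polynomial.smul_monomial])
  have := Module.Finite.of_basis b
  have := Module.Free.of_basis b
  exact IsCohenMacaulayRing.of_finite_flat K
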